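/- Let $\mathcal{C}$ be a $3$-uniform clutter on a finite vertex set $V$, that is, a collection of $3$-element subsets (circuits) of $V$ (vertices lying in no circuit are allowed). Let $\mathbb{K}$ be a field, $S=\mathbb{K}[x_v : v\in V]$ with the standard grading, and let $I=I(\mathcal{C})\subseteq S$ be the edge ideal, generated by the monomials $x_ux_vx_w$ with $\{u,v,w\}\in\mathcal{C}$. Let $\bar{\mathcal{C}}$ be the complement of $\mathcal{C}$, i.e. the clutter on $V$ whose circuits are all $3$-subsets of $V$ not in $\mathcal{C}$. For $W\subseteq V$, the induced subclutter $\bar{\mathcal{C}}[W]$ is the clutter on $W$ whose circuits are the circuits of $\bar{\mathcal{C}}$ contained in $W$; two clutters are isomorphic if a bijection of their vertex sets carries the circuits of one exactly onto those of the other. Let $\mathscr{C}=\{\mathcal{B},\mathcal{B}_1,\mathcal{B}_2,\mathcal{B}'\}$, where, writing $abc$ for $\{a,b,c\}$, $$\mathcal{B}=\{123,124,134,235,245,345\},\qquad \mathcal{B}_1=\mathcal{B}\cup\{125\},\qquad \mathcal{B}_2=\mathcal{B}\cup\{125,135\}$$ on the vertex set $\{1,\dots,5\}$, and $\mathcal{B}'=\binom{[6]}{3}\setminus\{123,456\}$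 on the vertex set $\{1,\dots,6\}$. For a monomial ideal $J\subseteq S$, let $\beta_{i,a}(J)$ ($a\in\mathbb{N}^V$) be the number of generators of multidegree $a$ in homological degree $i$ of the minimal multigraded free resolution $\cdots\to F_1\to F_0\to J\to 0$, and let $\beta_{i,j}(J)=\sum_{|a|=j}\beta_{i,a}(J)$, where $|a|=\sum_v a_v$. Call $J$ $r$-step linear ($r\ge 0$) if, for some $d$, $J$ is generated by homogeneous elements of degree $d$ and $\beta_{i,j}(J)=0$ for all $0\le i\le r$ and $j-i>d$, and put $\mathrm{index}(J)=\sup\{r : J\text{ is }r\text{-step linear}\}+1\in\mathbb{N}\cup\{\infty\}$. Then the following conditions are equivalent: (a) $\bar{\mathcal{C}}$ is $\mathscr{C}$-free, i.e. no induced subclutter of $\bar{\mathcal{C}}$ is isomorphic to a member of $\mathscr{C}$; (b) $\mathrm{index}(I)>1$ (that is, $I$ is linearly presented); (c) $\beta_{1,5}(I)=\beta_{1,6}(I)=0$. -/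

import Mathlib

open MvPolynomial

/-- A clutter on the finite vertex set `V`: a family of subsets of `V` (the circuits), none of which
properly contains another. Vertices lying in no circuit are permitted, so that complements and
induced subclutters are again clutters in this sense. -/
structure Clutter (V : Type*) where
  circuits : Finset (Finset V)
  antichain : IsAntichain (· ⊆ ·) (circuits : Set (Finset V))

namespace Clutter

variable {V U : Type*}

/-- All circuits have exactly `d` vertices. -/
def IsUniform (C : Clutter V) (d : ℕ) : Prop :=
  ∀ F ∈ C.circuits, F.card = d

/-- The clutter whose circuits are a given family of `d`-subsets. -/
def ofUniform (d : ℕ) (A : Finset (Finset V)) (hA : ∀ F ∈ A, F.card = d) : Clutter V where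
  circuits := A
  antichain := by
    intro F hF G hG hne hsub
    exact hne (Finset.eq_of_subset_of_card_le hsub (by rw [hA F hF, hA G hG]))

/-- The complement of a `d`-uniform clutter: all `d`-subsets of `V` that are not circuits. -/
def complement [Fintype V] [DecidableEq V] (C : Clutter V) (d : ℕ) : Clutter V :=
  ofUniform d (Finset.univ.powersetCard d \ C.circuits) (by
    intro F hF
    exact (Finset.mem_powersetCard.1 (Finset.mem_sdiff.1 hF).1).2)

/-- The induced subclutter `C[W]`, with vertex set `W` and as circuits the circuits of `C` that are
contained in `W`. -/
def induced [DecidableEq V] (C : Clutter V) (W : Finset V) : Clutter {v // v ∈ W} where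
  circuits := W.attach.powerset.filter
    (fun F => F.map (Function.Embedding.subtype (· ∈ W)) ∈ C.circuits)
  antichain := by
    intro F hF G hG hne hsub
    have hF' := (Finset.mem_filter.1 (Finset.mem_coe.1 hF)).2
    have hG' := (Finset.mem_filter.1 (Finset.mem_coe.1 hG)).2
    exact C.antichain hF' hG' (fun h => hne (Finset.map_injective _ h))
      (Finset.map_subset_map.2 hsub)

/-- Two clutters are isomorphic if some bijection of their vertex sets carries the circuits of one
exactly to the circuits of the other. -/
def IsIsomorphic (C : Clutter V) (D : Clutter U) : Prop :=
  ∃ e : V ≃ U, ∀ F : Finset V, F ∈ C.circuits ↔ F.map e.toEmbedding ∈ D.circuits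

/-- `C` is `𝓕`-free: no induced subclutter of `C` is isomorphic to a member of `𝓕`. -/
def IsFree [DecidableEq V] (C : Clutter V) (𝓕 : Set (Σ n : ℕ, Clutter (Fin n))) : Prop :=
  ∀ D ∈ 𝓕, ∀ W : Finset V, ¬ (C.induced W).IsIsomorphic D.2

/-- The boundary complex of the bi-pyramid over a triangle. The vertices `1, …, 5` are
represented by `0, …, 4`: the apexes are `0` and `4`, the base is the triangle `1 2 3`. -/
def bipyramid : Clutter (Fin 5) :=
  ofUniform 3 {{0, 1, 2}, {0, 1, 3}, {0, 2, 3}, {1, 2, 4}, {1, 3, 4}, {2, 3, 4}} (by decide)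

/-- The bi-pyramid together with the circuit `125`. -/
def bipyramid₁ : Clutter (Fin 5) :=
  ofUniform 3 (bipyramid.circuits ∪ {{0, 1, 4}}) (by decide)

/-- The bi-pyramid together with the circuits `125` and `135`. -/
def bipyramid₂ : Clutter (Fin 5) :=
  ofUniform 3 (bipyramid.circuits ∪ {{0, 1, 4}, {0, 2, 4}}) (by decide)

/-- All `3`-subsets of `{1, …, 6}` except `123` and `456`. -/
def twoGap : Clutter (Fin 6) :=
  ofUniform 3 (Finset.univ.powersetCard 3 \ {{0, 1, 2}, {3, 4, 5}}) (by
    intro F hF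
    exact (Finset.mem_powersetCard.1 (Finset.mem_sdiff.1 hF).1).2)

/-- The family of the four forbidden clutters. -/
def forbidden : Set (Σ n : ℕ, Clutter (Fin n)) :=
  {⟨5, bipyramid⟩, ⟨5, bipyramid₁⟩, ⟨5, bipyramid₂⟩, ⟨6, twoGap⟩}

/-- The edge ideal of a clutter, in the polynomial ring with one variable for each vertex. -/
noncomputable def edgeIdeal (K : Type*) [Field K] (C : Clutter V) : Ideal (MvPolynomial V K) :=
  Ideal.span {f | ∃ F ∈ C.circuits, f = ∏ v ∈ F, X v}

end Clutter

/-- A minimal multigraded free resolution `⋯ → F₂ → F₁ → F₀ → I → 0` of an ideal `I` of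
`S = K[x_v : v ∈ V]`. The module `F i` is free on `rank i` generators, of multidegrees
`deg i k`, i.e. `F i = ⨁ k, S(-deg i k)`. (The multidegrees of a minimal resolution of an ideal are
nonnegative, so they are taken in `V →₀ ℕ`.) -/
structure MinimalFreeResolution {V K : Type*} [Field K] (I : Ideal (MvPolynomial V K)) where
  rank : ℕ → ℕ
  deg : (i : ℕ) → Fin (rank i) → (V →₀ ℕ)
  /-- the augmentation `F 0 → S`, with image `I` -/
  aug : (Fin (rank 0) → MvPolynomial V K) →ₗ[MvPolynomial V K] MvPolynomial V K
  /-- the differentials `F (i + 1) → F i` -/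
  d : (i : ℕ) → (Fin (rank (i + 1)) → MvPolynomial V K) →ₗ[MvPolynomial V K]
    (Fin (rank i) → MvPolynomial V K)
  /-- `aug` preserves multidegrees -/
  aug_deg : ∀ k, ∀ m ∈ (aug (Pi.single k 1)).support, m = deg 0 k
  /-- `d i` preserves multidegrees: a monomial `m` in the `l`-th coordinate of `F i` has
  multidegree `m + deg i l` -/
  d_deg : ∀ i k l, ∀ m ∈ (d i (Pi.single k 1) l).support, m + deg i l = deg (i + 1) k
  range_aug : LinearMap.range aug = I
  exact_zero : LinearMap.range (d 0) = LinearMap.ker aug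
  exact_succ : ∀ i, LinearMap.range (d (i + 1)) = LinearMap.ker (d i)
  /-- minimality: all matrix entries of the differentials lie in the ideal generated by the
  variables -/
  minimal : ∀ i k l, constantCoeff (d i (Pi.single k 1) l) = 0

section Betti

variable {V K : Type*} [Field K]

open Classical in
/-- The multigraded Betti number `β_{i,a}(I)` of a monomial ideal `I`: the number of generators of
multidegree `a` in homological degree `i` of its minimal multigraded free resolution (which exists
for a monomial ideal in finitely many variables, and is unique up to isomorphism). -/
noncomputable def multigradedBetti (I : Ideal (MvPolynomial V K)) (i : ℕ) (a : V →₀ ℕ) : ℕ :=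
  if h : Nonempty (MinimalFreeResolution I) then Nat.card {k // h.some.deg i k = a} else 0

/-- The graded Betti number `β_{i,j}(I)`, the sum of the `β_{i,a}(I)` over the `a` with `|a| = j`. -/
noncomputable def gradedBetti [Fintype V] [DecidableEq V] (I : Ideal (MvPolynomial V K))
    (i j : ℕ) : ℕ :=
  ∑ a ∈ (Finset.univ : Finset V).finsuppAntidiag j, multigradedBetti I i a

/-- The ideal is generated by homogeneous polynomials of degree `d`. -/
def IsGeneratedInDegree (I : Ideal (MvPolynomial V K)) (d : ℕ) : Prop :=
  ∃ G : Set (MvPolynomial V K), (∀ g ∈ G, g.IsHomogeneous d) ∧ Ideal.span G = I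

/-- `I` is `r`-step linear: for some `d`, it is generated in degree `d` and `β_{i,j}(I) = 0`
whenever `0 ≤ i ≤ r` and `j - i > d`. -/
def IsStepLinear [Fintype V] [DecidableEq V] (I : Ideal (MvPolynomial V K)) (r : ℕ) : Prop :=
  ∃ d : ℕ, IsGeneratedInDegree I d ∧ ∀ i j : ℕ, i ≤ r → i + d < j → gradedBetti I i j = 0

/-- The Green-Lazarsfeld index `sup {r | I is r-step linear} + 1`. -/
noncomputable def glIndex [Fintype V] [DecidableEq V] (I : Ideal (MvPolynomial V K)) : ℕ∞ :=
  (⨆ r ∈ {r : ℕ | IsStepLinear I r}, (r : ℕ∞)) + 1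

end Betti

/-! For a multidegree `a` that is not the exponent of a generator, consider the graph on the
generators dividing `x^a` in which two are joined when their lcm is not `x^a`. Over any field, the
first syzygies of multidegree `a` measure how far this graph is from being connected. Two halves of
this principle suffice: `deg_one_ne` (connected, so no syzygy) and `exists_deg_one_eq` (an isolated
vertex beside another vertex, so some syzygy).

When `|a| ≥ 5`, circuits `F`, `G` are unjoined only if `a` is the exponent of `F ∪ G`, a set of five
or six vertices. Either other circuits connect `F` to `G`, or the complement contains a forbidden
clutter: `reflTransGen_linked_of_five` and `reflTransGen_linked_of_six`. This gives (a) ⇒ (b).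
Conversely, each forbidden clutter has a non-circuit that covers all vertices together with any
other non-circuit, which is an isolated vertex; this gives (c) ⇒ (a). Finally (b) ⇒ (c) is a
comparison of degrees, apart from the zero ideal, which is generated in every degree.

Betti numbers default to zero when there is no resolution, so nonvanishing also rests on
`nonempty_minimalFreeResolution`. -/

/-! ### Multigraded submodules of free modules and their minimal covers -/

section MultigradedVectors

variable {V K ι κ : Type*} [Field K]

/-- The vector `y` of `⨁ l, S(-deg l)` is homogeneous of multidegree `b`. -/
def IsMultihomogeneous (deg : ι → V →₀ ℕ) (b : V →₀ ℕ) (y : ι → MvPolynomial V K) : Prop :=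
  ∀ l, ∀ m ∈ (y l).support, m + deg l = b

/-- The submodule `N` of `⨁ l, S(-deg l)` is generated by homogeneous vectors. -/
def IsMultigraded (deg : ι → V →₀ ℕ)
    (N : Submodule (MvPolynomial V K) (ι → MvPolynomial V K)) : Prop :=
  N ≤ Submodule.span _ {y | y ∈ N ∧ ∃ b, IsMultihomogeneous deg b y}

open Classical in
/-- The component of multidegree `b` of a vector of `⨁ l, S(-deg l)`. -/
noncomputable def multigradedComponent (deg : ι → V →₀ ℕ) (b : V →₀ ℕ)
    (y : ι → MvPolynomial V K) : ι → MvPolynomial V K :=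
  fun l => if deg l ≤ b then monomial (b - deg l) (coeff (b - deg l) (y l)) else 0

open Classical in
theorem coeff_multigradedComponent (deg : ι → V →₀ ℕ) (b : V →₀ ℕ)
    (y : ι → MvPolynomial V K) (l : ι) (q : V →₀ ℕ) :
    coeff q (multigradedComponent deg b y l) = if q + deg l = b then coeff q (y l) else 0 := by
  unfold multigradedComponent
  split_ifs with h1 h2 h2
  · subst h2
    simp
  · rw [coeff_monomial, if_neg]
    rintro rfl
    exact h2 (tsub_add_cancel_of_le h1)
  · exact absurd (h2 ▸ le_add_self) h1
  · simp

theorem isMultihomogeneous_component (deg : ι → V →₀ ℕ) (b : V →₀ ℕ)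
    (y : ι → MvPolynomial V K) : IsMultihomogeneous deg b (multigradedComponent deg b y) := by
  classical
  intro l q hq
  rw [mem_support_iff, coeff_multigradedComponent] at hq
  by_contra h
  simp [h] at hq

theorem exists_eq_sum_component [Fintype ι] (deg : ι → V →₀ ℕ) (y : ι → MvPolynomial V K) :
    ∃ B : Finset (V →₀ ℕ), y = ∑ b ∈ B, multigradedComponent deg b y := by
  classical
  refine ⟨Finset.univ.biUnion fun l => (y l).support.image (· + deg l), ?_⟩
  funext l
  ext q
  rw [Finset.sum_apply, coeff_sum]
  simp_rw [coeff_multigradedComponent]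
  rw [Finset.sum_ite_eq]
  split_ifs with h
  · rfl
  · by_contra h0
    exact h (Finset.mem_biUnion.2 ⟨l, Finset.mem_univ _,
      Finset.mem_image.2 ⟨q, mem_support_iff.2 h0, rfl⟩⟩)

/-- The map given by the `v k` preserves multidegrees, so it commutes with taking components; hence
its kernel is multigraded. -/
theorem component_linearCombination [Fintype κ] {deg : ι → V →₀ ℕ} {deg' : κ → V →₀ ℕ}
    {v : κ → ι → MvPolynomial V K} (hv : ∀ k, IsMultihomogeneous deg (deg' k) (v k))
    (b : V →₀ ℕ) (y : κ → MvPolynomial V K) :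
    Fintype.linearCombination (MvPolynomial V K) v (multigradedComponent deg' b y) =
      multigradedComponent deg b (Fintype.linearCombination (MvPolynomial V K) v y) := by
  classical
  funext l
  ext q
  rw [coeff_multigradedComponent]
  simp only [Fintype.linearCombination_apply, Finset.sum_apply, Pi.smul_apply, smul_eq_mul,
    coeff_sum, coeff_mul, coeff_multigradedComponent]
  have key : ∀ k, ∀ x ∈ Finset.HasAntidiagonal.antidiagonal q,
      (if x.1 + deg' k = b then coeff x.1 (y k) else 0) * coeff x.2 (v k l) =
        if q + deg l = b then coeff x.1 (y k) * coeff x.2 (v k l) else 0 := by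
    intro k x hx
    by_cases h0 : coeff x.2 (v k l) = 0
    · simp [h0]
    · have h1 : q + deg l = x.1 + deg' k := by
        rw [← hv k l x.2 (mem_support_iff.2 h0), ← Finset.HasAntidiagonal.mem_antidiagonal.1 hx, add_assoc]
      rw [h1, ite_mul, zero_mul]
  rw [Finset.sum_congr rfl fun k _ => Finset.sum_congr rfl (key k)]
  split_ifs <;> simp

theorem multigradedComponent_of_forall [Fintype ι] {deg : ι → V →₀ ℕ}
    {N : Submodule (MvPolynomial V K) (ι → MvPolynomial V K)}
    (h : ∀ b, ∀ y ∈ N, multigradedComponent deg b y ∈ N) : IsMultigraded deg N := by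
  intro y hy
  obtain ⟨B, hB⟩ := exists_eq_sum_component deg y
  rw [hB]
  exact Submodule.sum_mem _ fun b _ => Submodule.subset_span
    ⟨h b y hy, b, isMultihomogeneous_component deg b y⟩

theorem multigradedComponent_zero (deg : ι → V →₀ ℕ) (b : V →₀ ℕ) :
    multigradedComponent deg b (0 : ι → MvPolynomial V K) = 0 := by
  classical
  funext l
  ext q
  rw [coeff_multigradedComponent]
  simp

theorem isMultigraded_ker [Fintype κ] {deg : ι → V →₀ ℕ} {deg' : κ → V →₀ ℕ}
    {v : κ → ι → MvPolynomial V K} (hv : ∀ k, IsMultihomogeneous deg (deg' k) (v k)) :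
    IsMultigraded deg' (LinearMap.ker (Fintype.linearCombination (MvPolynomial V K) v)) := by
  refine multigradedComponent_of_forall fun b y hy => ?_
  rw [LinearMap.mem_ker] at hy ⊢
  rw [component_linearCombination hv, hy, multigradedComponent_zero]

/-- A multigraded submodule of a finite free module has an irredundant finite set of homogeneous
generators. -/
theorem IsMultigraded.exists_irredundant [Finite V] [Finite ι] {deg : ι → V →₀ ℕ}
    {N : Submodule (MvPolynomial V K) (ι → MvPolynomial V K)} (hN : IsMultigraded deg N) :
    ∃ T : Finset (ι → MvPolynomial V K), (∀ t ∈ T, ∃ b, IsMultihomogeneous deg b t) ∧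
      Submodule.span (MvPolynomial V K) (T : Set (ι → MvPolynomial V K)) = N ∧
      ∀ t ∈ T, t ∉ Submodule.span (MvPolynomial V K)
        ((T : Set (ι → MvPolynomial V K)) \ {t}) := by
  classical
  -- Irredundance comes from minimizing the cardinality of a homogeneous generating set;
  -- noetherianity provides a finite one.
  let P : ℕ → Prop := fun c => ∃ T : Finset (ι → MvPolynomial V K), T.card = c ∧
    (∀ t ∈ T, ∃ b, IsMultihomogeneous deg b t) ∧
      Submodule.span (MvPolynomial V K) (T : Set (ι → MvPolynomial V K)) = N
  have hspan : Submodule.span _ {y | y ∈ N ∧ ∃ b, IsMultihomogeneous deg b y} = N :=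
    le_antisymm (Submodule.span_le.2 fun y hy => hy.1) hN
  have hfg : (Submodule.span (MvPolynomial V K) {y | y ∈ N ∧ ∃ b, IsMultihomogeneous deg b y}).FG :=
    IsNoetherian.noetherian _
  obtain ⟨T, hT, hTs⟩ := (Submodule.fg_span_iff_fg_span_finset_subset _).1 hfg
  have hex : ∃ c, P c := ⟨T.card, T, rfl, fun t ht => (hT ht).2, hTs.symm.trans hspan⟩
  obtain ⟨T, hc, hh, hs⟩ := Nat.find_spec hex
  refine ⟨T, hh, hs, fun t ht hmem => ?_⟩
  refine Nat.find_min hex (m := (T.erase t).card) ?_ ⟨T.erase t, rfl,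
    fun s hs => hh s (Finset.mem_of_mem_erase hs), ?_⟩
  · rw [← hc]
    exact Finset.card_erase_lt_of_mem ht
  · rw [← hs, Finset.coe_erase]
    refine le_antisymm (Submodule.span_mono Set.sdiff_subset) (Submodule.span_le.2 fun s hs => ?_)
    by_cases h : s = t
    · exact h ▸ hmem
    · exact Submodule.subset_span ⟨hs, h⟩

/-- The homogeneous vectors of `N` have all their entries in the ideal generated by the
variables. -/
def IsMinimallyPresented (deg : ι → V →₀ ℕ)
    (N : Submodule (MvPolynomial V K) (ι → MvPolynomial V K)) : Prop :=
  ∀ b, ∀ y ∈ N, IsMultihomogeneous deg b y → ∀ l, constantCoeff (y l) = 0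

/-- Nakayama in multigraded form: by homogeneity, an entry with nonzero constant term is a nonzero
scalar, and the relation could be solved for `v k`. -/
theorem isMinimallyPresented_ker [Fintype κ] {deg' : κ → V →₀ ℕ}
    {v : κ → ι → MvPolynomial V K}
    (hirr : ∀ k, v k ∉ Submodule.span (MvPolynomial V K) (v '' {k}ᶜ)) :
    IsMinimallyPresented deg'
      (LinearMap.ker (Fintype.linearCombination (MvPolynomial V K) v)) := by
  classical
  intro b y hy hb k
  by_contra h0
  rw [constantCoeff_eq] at h0
  have hk : deg' k = b := by simpa using hb k 0 (mem_support_iff.2 h0)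
  have hyk : y k = C (coeff 0 (y k)) := by
    ext q
    rw [coeff_C]
    split_ifs with hq
    · rw [← hq]
    · by_contra h1
      have := hb k q (mem_support_iff.2 h1)
      rw [hk] at this
      exact hq (by simpa using this.symm : q = 0).symm
  rw [LinearMap.mem_ker, Fintype.linearCombination_apply, ← Finset.add_sum_erase _ _
    (Finset.mem_univ k), hyk] at hy
  refine hirr k ?_
  have hvk : v k = (C (coeff 0 (y k))⁻¹ : MvPolynomial V K) •
      ((C (coeff 0 (y k)) : MvPolynomial V K) • v k) := by
    rw [smul_smul, ← C_mul, inv_mul_cancel₀ h0, C_1, one_smul]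
  rw [hvk, eq_neg_of_add_eq_zero_left hy]
  refine Submodule.smul_mem _ _ (Submodule.neg_mem _ (Submodule.sum_mem _ fun j hj =>
    Submodule.smul_mem _ _ (Submodule.subset_span ⟨j, Finset.ne_of_mem_erase hj, rfl⟩)))

/-- One step of a minimal multigraded free resolution. -/
theorem IsMultigraded.exists_cover [Finite V] [Finite ι] {deg : ι → V →₀ ℕ}
    {N : Submodule (MvPolynomial V K) (ι → MvPolynomial V K)} (hN : IsMultigraded deg N) :
    ∃ (n : ℕ) (deg' : Fin n → V →₀ ℕ)
      (d : (Fin n → MvPolynomial V K) →ₗ[MvPolynomial V K] (ι → MvPolynomial V K)),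
      (∀ k, IsMultihomogeneous deg (deg' k) (d (Pi.single k 1))) ∧ LinearMap.range d = N ∧
      IsMultigraded deg' (LinearMap.ker d) ∧ IsMinimallyPresented deg' (LinearMap.ker d) := by
  classical
  obtain ⟨T, hh, hs, hirr⟩ := hN.exists_irredundant
  let v : Fin T.card → ι → MvPolynomial V K := fun k => (T.equivFin.symm k : ι → MvPolynomial V K)
  have hinj : Function.Injective v :=
    Subtype.val_injective.comp T.equivFin.symm.injective
  have hmem : ∀ k, v k ∈ T := fun k => (T.equivFin.symm k).2
  have hrange : Set.range v = T := by
    ext t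
    constructor
    · rintro ⟨k, rfl⟩
      exact hmem k
    · intro ht
      exact ⟨T.equivFin ⟨t, ht⟩, by simp [v]⟩
  choose deg' hdeg' using fun k => hh (v k) (hmem k)
  refine ⟨T.card, deg', Fintype.linearCombination _ v, fun k => ?_, ?_, isMultigraded_ker hdeg',
    isMinimallyPresented_ker fun k => ?_⟩
  · rw [Fintype.linearCombination_apply_single, one_smul]
    exact hdeg' k
  · rw [Fintype.range_linearCombination, hrange, hs]
  · rw [Set.image_compl_eq_range_sdiff_image hinj, Set.image_singleton, hrange]
    exact hirr _ (hmem k)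

end MultigradedVectors

/-! ### Existence of minimal multigraded free resolutions -/

section Existence

variable {V K : Type*} [Field K]

/-- A multigraded module of syzygies on finitely many homogeneous generators. -/
structure MultigradedSyzygies (V K : Type*) [Field K] where
  rank : ℕ
  deg : Fin rank → V →₀ ℕ
  syz : Submodule (MvPolynomial V K) (Fin rank → MvPolynomial V K)
  isMultigraded : IsMultigraded deg syz
  isMinimallyPresented : IsMinimallyPresented deg syz

theorem MultigradedSyzygies.exists_next [Finite V] (s : MultigradedSyzygies V K) :
    ∃ (t : MultigradedSyzygies V K)
      (d : (Fin t.rank → MvPolynomial V K) →ₗ[MvPolynomial V K]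
        (Fin s.rank → MvPolynomial V K)),
      (∀ k, IsMultihomogeneous s.deg (t.deg k) (d (Pi.single k 1))) ∧
      LinearMap.range d = s.syz ∧ LinearMap.ker d = t.syz := by
  obtain ⟨n, deg', d, h1, h2, h3, h4⟩ := s.isMultigraded.exists_cover
  exact ⟨⟨n, deg', LinearMap.ker d, h3, h4⟩, d, h1, h2, rfl⟩

/-- Iterate `exists_cover`, starting from the ideal as a submodule of a free module of rank one.
Minimality of each differential is the `isMinimallyPresented` property of the syzygies it covers. -/
theorem nonempty_minimalFreeResolution [Finite V] (G : Set (V →₀ ℕ)) :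
    Nonempty (MinimalFreeResolution
      (Ideal.span ((fun g => monomial g (1 : K)) '' G))) := by
  classical
  let φ : MvPolynomial V K →ₗ[MvPolynomial V K] (Fin 1 → MvPolynomial V K) :=
    LinearMap.pi fun _ => LinearMap.id
  let N := Submodule.map φ (Ideal.span ((fun g => monomial g (1 : K)) '' G))
  have hN : IsMultigraded (fun _ => 0) N := by
    have : N = Submodule.span _ (φ '' ((fun g => monomial g (1 : K)) '' G)) :=
      Submodule.map_span _ _
    intro y hy
    rw [this] at hy
    refine Submodule.span_mono ?_ hy
    rintro _ ⟨_, ⟨g, hg, rfl⟩, rfl⟩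
    refine ⟨Submodule.mem_map_of_mem (Ideal.subset_span ⟨g, hg, rfl⟩), g, fun l m hm => ?_⟩
    have : m ∈ (monomial g (1 : K)).support := hm
    rw [mem_support_iff, coeff_monomial] at this
    rw [add_zero]
    by_contra h
    exact this (if_neg fun h' => h h'.symm)
  obtain ⟨n, deg₀, d₀, h1, h2, h3, h4⟩ := hN.exists_cover
  choose next δ hδ hrange hker using fun s : MultigradedSyzygies V K => s.exists_next
  let st : ℕ → MultigradedSyzygies V K :=
    fun i => Nat.rec ⟨n, deg₀, LinearMap.ker d₀, h3, h4⟩ (fun _ s => next s) i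
  have hproj : ∀ y, (LinearMap.proj 0 ∘ₗ d₀) y = d₀ y 0 := fun _ => rfl
  refine ⟨{
    rank := fun i => (st i).rank
    deg := fun i => (st i).deg
    aug := LinearMap.proj 0 ∘ₗ d₀
    d := fun i => δ (st i)
    aug_deg := fun k m hm => (add_zero m).symm.trans (h1 k 0 m hm)
    d_deg := fun i k l m hm => hδ (st i) k l m hm
    range_aug := ?_
    exact_zero := ?_
    exact_succ := fun i => (hrange (st (i + 1))).trans (hker (st i)).symm
    minimal := fun i k l => (st i).isMinimallyPresented _ _
      (hrange (st i) ▸ LinearMap.mem_range_self _ _) (hδ (st i) k) l }⟩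
  · rw [LinearMap.range_comp, h2, ← Submodule.map_comp]
    exact Submodule.map_id _
  · rw [hrange (st 0)]
    ext y
    change d₀ y = 0 ↔ d₀ y 0 = 0
    rw [_root_.funext_iff]
    simp

end Existence

/-! ### First syzygies of a monomial ideal, read off from lcms -/

section Syzygies

variable {V K : Type*} [Field K]

theorem LinearMap.pi_apply_eq_sum_single {R M ι : Type*} [CommSemiring R] [AddCommMonoid M]
    [Module R M] [Fintype ι] [DecidableEq ι] (f : (ι → R) →ₗ[R] M) (y : ι → R) :
    f y = ∑ i, y i • f (Pi.single i 1) := by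
  conv_lhs => rw [pi_eq_sum_univ' y, map_sum]
  refine Finset.sum_congr rfl fun i _ => ?_
  rw [map_smul]

/-- The second clause guards the truncated subtraction: `b - e` is a true difference whenever the
coefficient is nonzero. -/
theorem exists_eq_monomial {p : MvPolynomial V K} {e b : V →₀ ℕ}
    (h : ∀ m ∈ p.support, m + e = b) : ∃ c, p = monomial (b - e) c ∧ (c ≠ 0 → e ≤ b) := by
  classical
  refine ⟨coeff (b - e) p, ?_, fun hc => ?_⟩
  · ext m
    rw [coeff_monomial]
    split_ifs with hm
    · rw [hm]
    · by_contra h0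
      exact hm (by rw [← h m (mem_support_iff.2 h0), add_tsub_cancel_right])
  · rw [← h _ (mem_support_iff.2 hc)]
    exact le_add_self

namespace MinimalFreeResolution

variable {I : Ideal (MvPolynomial V K)} (R : MinimalFreeResolution I)

/-- The coefficient of the monomial to which the augmentation sends a basis element. -/
noncomputable def unitCoeff (l : Fin (R.rank 0)) : K :=
  coeff (R.deg 0 l) (R.aug (Pi.single l 1))

theorem aug_single (l : Fin (R.rank 0)) :
    R.aug (Pi.single l 1) = monomial (R.deg 0 l) (R.unitCoeff l) := by
  classical
  ext m
  rw [coeff_monomial]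
  split_ifs with hm
  · rw [unitCoeff, hm]
  · by_contra h0
    exact hm (R.aug_deg l m (mem_support_iff.2 h0)).symm

theorem aug_apply (y : Fin (R.rank 0) → MvPolynomial V K) :
    R.aug y = ∑ l, y l * monomial (R.deg 0 l) (R.unitCoeff l) := by
  rw [LinearMap.pi_apply_eq_sum_single]
  simp [aug_single]

theorem constantCoeff_d (i : ℕ) (y : Fin (R.rank (i + 1)) → MvPolynomial V K)
    (l : Fin (R.rank i)) : constantCoeff (R.d i y l) = 0 := by
  rw [LinearMap.pi_apply_eq_sum_single, Finset.sum_apply, map_sum]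
  exact Finset.sum_eq_zero fun k _ => by simp [R.minimal]

theorem aug_d (y : Fin (R.rank 1) → MvPolynomial V K) : R.aug (R.d 0 y) = 0 :=
  LinearMap.mem_ker.1 (R.exact_zero ▸ LinearMap.mem_range_self _ _)

theorem constantCoeff_of_aug_eq_zero {y : Fin (R.rank 0) → MvPolynomial V K} (hy : R.aug y = 0)
    (l : Fin (R.rank 0)) : constantCoeff (y l) = 0 := by
  have : y ∈ LinearMap.range (R.d 0) := R.exact_zero ▸ LinearMap.mem_ker.2 hy
  obtain ⟨z, rfl⟩ := this
  exact R.constantCoeff_d 0 z l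

theorem unitCoeff_ne_zero (l : Fin (R.rank 0)) : R.unitCoeff l ≠ 0 := by
  intro h
  have := R.constantCoeff_of_aug_eq_zero (y := Pi.single l 1) (by simp [aug_single, h]) l
  simp at this

end MinimalFreeResolution

variable {G : Set (V →₀ ℕ)}
  (R : MinimalFreeResolution (Ideal.span ((fun g => monomial g (1 : K)) '' G)))

namespace MinimalFreeResolution

theorem exists_le_deg (l : Fin (R.rank 0)) : ∃ g ∈ G, g ≤ R.deg 0 l := by
  classical
  have h : R.aug (Pi.single l 1) ∈ Ideal.span ((fun g => monomial g (1 : K)) '' G) := by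
    have h' := LinearMap.mem_range_self R.aug (Pi.single l 1)
    rwa [R.range_aug] at h'
  refine mem_ideal_span_monomial_image.1 h _ ?_
  rw [mem_support_iff, aug_single, coeff_monomial, if_pos rfl]
  exact R.unitCoeff_ne_zero l

/-- Some basis degree divides `g` and is itself divisible by a member of `G`; the antichain
condition forces equality. -/
theorem exists_deg_eq (hG : IsAntichain (· ≤ ·) G) {g : V →₀ ℕ} (hg : g ∈ G) :
    ∃ l, R.deg 0 l = g := by
  classical
  have h : monomial g (1 : K) ∈ LinearMap.range R.aug := by
    rw [R.range_aug]
    exact Ideal.subset_span ⟨g, hg, rfl⟩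
  obtain ⟨y, hy⟩ := h
  have h1 : coeff g (R.aug y) ≠ 0 := by simp [hy]
  rw [aug_apply, coeff_sum] at h1
  obtain ⟨l, -, hl⟩ := Finset.exists_ne_zero_of_sum_ne_zero h1
  rw [coeff_mul_monomial'] at hl
  have hle : R.deg 0 l ≤ g := by
    by_contra h'
    simp [h'] at hl
  obtain ⟨g', hg', hle'⟩ := R.exists_le_deg l
  refine ⟨l, le_antisymm hle ?_⟩
  rwa [← hG.eq hg' hg (hle'.trans hle)]

/-- If the degree of `l` were a proper multiple of a generator, subtracting a multiple of the basis
element `l'` would give a syzygy with constant entry `1` at `l`, against minimality. -/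
theorem deg_mem (hG : IsAntichain (· ≤ ·) G) (l : Fin (R.rank 0)) : R.deg 0 l ∈ G := by
  classical
  obtain ⟨g, hg, hle⟩ := R.exists_le_deg l
  obtain ⟨l', hl'⟩ := R.exists_deg_eq hG hg
  by_cases h : R.deg 0 l' = R.deg 0 l
  · rw [← h, hl']
    exact hg
  have hne : l ≠ l' := fun h' => h (by rw [h'])
  have key := R.constantCoeff_of_aug_eq_zero
    (y := Pi.single l 1 - monomial (R.deg 0 l - g) (R.unitCoeff l * (R.unitCoeff l')⁻¹) •
      Pi.single l' 1) ?_ l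
  · simp [hne] at key
  · rw [map_sub, map_smul, aug_single, aug_single, smul_eq_mul, monomial_mul, hl',
      tsub_add_cancel_of_le hle, inv_mul_cancel_right₀ (R.unitCoeff_ne_zero l'), sub_self]

/-- If some generator of `I` dividing `x^a` has least common multiple `x^a` with every other
generator dividing `x^a`, then there is a minimal syzygy of multidegree `a`. -/
theorem exists_deg_one_eq (hG : IsAntichain (· ≤ ·) G) {a g₀ g₁ : V →₀ ℕ} (h₀ : g₀ ∈ G)
    (h₁ : g₁ ∈ G) (hne : g₁ ≠ g₀) (h₀a : g₀ ≤ a) (h₁a : g₁ ≤ a)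
    (hiso : ∀ g ∈ G, g ≤ a → g ≠ g₀ → g₀ ⊔ g = a) : ∃ k, R.deg 1 k = a := by
  classical
  by_contra! hk
  -- `ψ` is the part of the augmentation coming from basis elements over `g₀`. If no syzygy
  -- generator had multidegree `a`, then `ψ` would kill the `x^a`-part of every syzygy.
  let ψ := Fintype.linearCombination (MvPolynomial V K) fun l =>
    if g₀ ≤ R.deg 0 l then monomial (R.deg 0 l) (R.unitCoeff l) else 0
  have hψ : ∀ y, ψ y =
      ∑ l, if g₀ ≤ R.deg 0 l then y l * monomial (R.deg 0 l) (R.unitCoeff l) else 0 := by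
    intro y
    simp [ψ, Fintype.linearCombination_apply]
  have hvan : ∀ k, ∃ s, ψ (R.d 0 (Pi.single k 1)) = monomial (R.deg 1 k) s ∧
      (R.deg 1 k ≤ a → s = 0) := by
    intro k
    choose c hc hcle using fun l => exists_eq_monomial (R.d_deg 0 k l)
    have hT : ∀ l, R.d 0 (Pi.single k 1) l * monomial (R.deg 0 l) (R.unitCoeff l) =
        monomial (R.deg 1 k) (c l * R.unitCoeff l) := by
      intro l
      by_cases h : c l = 0
      · rw [hc l]
        simp [h]
      · rw [hc l, monomial_mul, tsub_add_cancel_of_le (hcle l h)]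
    refine ⟨∑ l, if g₀ ≤ R.deg 0 l then c l * R.unitCoeff l else 0, ?_, fun hle => ?_⟩
    · rw [hψ, map_sum]
      refine Finset.sum_congr rfl fun l _ => ?_
      split_ifs
      · exact hT l
      · simp
    -- If a syzygy of degree properly below `a` involves `g₀`, it involves nothing else, as the lcm
    -- would already be `a`. Then `ψ` agrees with the full augmentation on it and vanishes.
    · by_cases hex : ∃ l, c l ≠ 0 ∧ g₀ ≤ R.deg 0 l
      · obtain ⟨l, hl, hgl⟩ := hex
        have hsum := R.aug_d (Pi.single k 1)
        rw [aug_apply, Finset.sum_congr rfl fun l _ => hT l, ← map_sum, monomial_eq_zero] at hsum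
        refine Eq.trans ?_ hsum
        refine Finset.sum_congr rfl fun l' _ => ?_
        by_cases hl' : c l' = 0
        · simp [hl']
        refine if_pos ?_
        obtain ⟨g, hg, hgle⟩ := R.exists_le_deg l'
        by_cases hgg : g = g₀
        · rwa [← hgg]
        · have hge := hiso g hg ((hgle.trans (hcle l' hl')).trans hle) hgg
          exact absurd (le_antisymm hle
            (hge ▸ sup_le (hgl.trans (hcle l hl)) (hgle.trans (hcle l' hl')))) (hk k)
      · push Not at hex
        refine Finset.sum_eq_zero fun l _ => ?_
        split_ifs with h
        · by_cases hl : c l = 0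
          · simp [hl]
          · exact absurd h (hex l hl)
        · rfl
  have hzero : ∀ z, coeff a (ψ (R.d 0 z)) = 0 := by
    intro z
    rw [← LinearMap.comp_apply, LinearMap.pi_apply_eq_sum_single, coeff_sum]
    refine Finset.sum_eq_zero fun k _ => ?_
    obtain ⟨s, hs, hs0⟩ := hvan k
    rw [LinearMap.comp_apply, hs, smul_eq_mul, coeff_mul_monomial']
    split_ifs with h
    · rw [hs0 h, mul_zero]
    · rfl
  obtain ⟨l₀, rfl⟩ := R.exists_deg_eq hG h₀
  obtain ⟨l₁, rfl⟩ := R.exists_deg_eq hG h₁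
  -- The lcm-type syzygy between `g₀` and `g₁`, scaled to degree `a`: `ψ` sees only its first term,
  -- which is nonzero.
  let y : Fin (R.rank 0) → MvPolynomial V K :=
    monomial (a - R.deg 0 l₀) (R.unitCoeff l₁) • Pi.single l₀ 1 -
      monomial (a - R.deg 0 l₁) (R.unitCoeff l₀) • Pi.single l₁ 1
  have hy : y ∈ LinearMap.range (R.d 0) := by
    rw [R.exact_zero, LinearMap.mem_ker]
    simp only [y, map_sub, map_smul, aug_single, smul_eq_mul, monomial_mul,
      tsub_add_cancel_of_le h₀a, tsub_add_cancel_of_le h₁a]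
    rw [mul_comm, sub_self]
  obtain ⟨z, hz⟩ := hy
  have h := hzero z
  have hψs : ∀ l, ψ (Pi.single l 1) =
      if R.deg 0 l₀ ≤ R.deg 0 l then monomial (R.deg 0 l) (R.unitCoeff l) else 0 := by
    intro l
    simp [ψ, Fintype.linearCombination_apply_single]
  have hnle : ¬ R.deg 0 l₀ ≤ R.deg 0 l₁ := fun h' => hne (hG.eq h₀ h₁ h').symm
  rw [hz, map_sub, map_smul, map_smul, hψs, hψs, if_pos le_rfl, if_neg hnle, smul_zero, sub_zero,
    smul_eq_mul, monomial_mul, tsub_add_cancel_of_le h₀a, coeff_monomial, if_pos rfl] at h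
  exact mul_ne_zero (R.unitCoeff_ne_zero _) (R.unitCoeff_ne_zero _) h

/-- If the generators of `I` dividing `x^a` are connected through pairs whose least common multiple
is not `x^a`, then there is no minimal syzygy of multidegree `a`. -/
theorem deg_one_ne (hG : IsAntichain (· ≤ ·) G) {a : V →₀ ℕ} (ha : a ∉ G)
    (hconn : ∀ g ∈ G, ∀ g' ∈ G, g ≤ a → g' ≤ a →
      Relation.ReflTransGen (fun p q => p ∈ G ∧ q ∈ G ∧ p ≤ a ∧ q ≤ a ∧ p ⊔ q ≠ a) g g')
    (k : Fin (R.rank 1)) : R.deg 1 k ≠ a := by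
  classical
  rintro rfl
  set a := R.deg 1 k
  let 𝔪 : Ideal (MvPolynomial V K) := RingHom.ker constantCoeff
  -- For degrees below `a`, `v l` is the basis element scaled to have image `x^a`. A joined pair
  -- differs by `x^(a - c)` times their syzygy at the lcm `c ≠ a`, hence by an element of `𝔪 • ker`.
  let v : Fin (R.rank 0) → Fin (R.rank 0) → MvPolynomial V K := fun l =>
    monomial (a - R.deg 0 l) (R.unitCoeff l)⁻¹ • Pi.single l 1
  have hpair : ∀ l l', R.deg 0 l ≤ a → R.deg 0 l' ≤ a → R.deg 0 l ⊔ R.deg 0 l' ≠ a →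
      v l - v l' ∈ 𝔪 • LinearMap.ker R.aug := by
    intro l l' hl hl' hsup
    set c := R.deg 0 l ⊔ R.deg 0 l' with hc
    have hca : c ≤ a := sup_le hl hl'
    have hlc : R.deg 0 l ≤ c := le_sup_left
    have hlc' : R.deg 0 l' ≤ c := le_sup_right
    have : v l - v l' = monomial (a - c) (1 : K) •
        (monomial (c - R.deg 0 l) (R.unitCoeff l)⁻¹ • Pi.single l (1 : MvPolynomial V K) -
          monomial (c - R.deg 0 l') (R.unitCoeff l')⁻¹ • Pi.single l' 1) := by
      rw [smul_sub, smul_smul, smul_smul, monomial_mul, monomial_mul, one_mul, one_mul,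
        tsub_add_tsub_cancel hca hlc, tsub_add_tsub_cancel hca hlc']
    rw [this]
    refine Submodule.smul_mem_smul ?_ ?_
    · rw [RingHom.mem_ker, constantCoeff_monomial, if_neg]
      intro h
      exact hsup (le_antisymm hca (tsub_eq_zero_iff_le.1 h))
    · rw [LinearMap.mem_ker, map_sub, map_smul, map_smul, aug_single, aug_single, smul_eq_mul,
        smul_eq_mul, monomial_mul, monomial_mul, tsub_add_cancel_of_le hlc,
        tsub_add_cancel_of_le hlc', inv_mul_cancel₀ (R.unitCoeff_ne_zero _),
        inv_mul_cancel₀ (R.unitCoeff_ne_zero _), sub_self]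
  have hpath : ∀ g g', Relation.ReflTransGen
      (fun p q => p ∈ G ∧ q ∈ G ∧ p ≤ a ∧ q ≤ a ∧ p ⊔ q ≠ a) g g' → g ≤ a →
      ∀ l l', R.deg 0 l = g → R.deg 0 l' = g' → v l - v l' ∈ 𝔪 • LinearMap.ker R.aug := by
    intro g g' h hga
    induction h with
    | refl =>
      intro l l' hl hl'
      -- Here `l` and `l'` may be distinct basis elements of the same degree, so `a ∉ G` is what
      -- excludes lcm `a`.
      refine hpair l l' (hl ▸ hga) (hl' ▸ hga) ?_
      rw [hl, hl', sup_idem, ← hl]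
      exact fun h => ha (h ▸ R.deg_mem hG l)
    | tail _ hstep ih =>
      intro l l' hl hl'
      obtain ⟨hp, -, hpa, hqa, hsup⟩ := hstep
      obtain ⟨l'', rfl⟩ := R.exists_deg_eq hG hp
      subst hl'
      rw [← sub_add_sub_cancel _ (v l'')]
      exact Submodule.add_mem _ (ih l l'' hl rfl) (hpair l'' l' hpa hqa hsup)
  have hall : ∀ l l', R.deg 0 l ≤ a → R.deg 0 l' ≤ a → v l - v l' ∈ 𝔪 • LinearMap.ker R.aug :=
    fun l l' hl hl' => hpath _ _
      (hconn _ (R.deg_mem hG l) _ (R.deg_mem hG l') hl hl') hl l l' rfl rfl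
  choose c hc hcle using fun l => exists_eq_monomial (R.d_deg 0 k l)
  have hσ : R.d 0 (Pi.single k 1) =
      ∑ l, (C (c l * R.unitCoeff l) : MvPolynomial V K) • v l := by
    rw [pi_eq_sum_univ' (R.d 0 (Pi.single k 1))]
    refine Finset.sum_congr rfl fun l _ => ?_
    rw [smul_smul, C_mul_monomial, mul_inv_cancel_right₀ (R.unitCoeff_ne_zero l), ← hc l]
  have hsum : ∑ l, c l * R.unitCoeff l = 0 := by
    have h := R.aug_d (Pi.single k 1)
    rw [aug_apply] at h
    rw [← monomial_eq_zero (s := a), ← h, map_sum]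
    refine Finset.sum_congr rfl fun l _ => ?_
    rw [hc l]
    by_cases hl : c l = 0
    · simp [hl]
    · rw [monomial_mul, tsub_add_cancel_of_le (hcle l hl)]
  -- The coefficients on the `v l` sum to zero, so the syzygy is a combination of differences `v l -
  -- v l₀`.
  have hmem : R.d 0 (Pi.single k 1) ∈ 𝔪 • LinearMap.ker R.aug := by
    by_cases hex : ∃ l, c l ≠ 0
    · obtain ⟨l₀, hl₀⟩ := hex
      have : R.d 0 (Pi.single k 1) =
          ∑ l, (C (c l * R.unitCoeff l) : MvPolynomial V K) • (v l - v l₀) := by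
        simp_rw [smul_sub]
        rw [Finset.sum_sub_distrib, ← Finset.sum_smul, ← map_sum, hsum, map_zero, zero_smul,
          sub_zero, hσ]
      rw [this]
      refine Submodule.sum_mem _ fun l _ => ?_
      by_cases hl : c l = 0
      · simp [hl]
      · exact Submodule.smul_mem _ _ (hall l l₀ (hcle l hl) (hcle l₀ hl₀))
    · push Not at hex
      rw [hσ]
      simp [hex]
  rw [← R.exact_zero, LinearMap.range_eq_map, ← Submodule.map_smul''] at hmem
  obtain ⟨y, hy, hyd⟩ := hmem
  have hy0 : ∀ j, constantCoeff (y j) = 0 := by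
    refine Submodule.smul_induction_on hy (fun r hr n _ j => ?_) fun y z hy hz j => ?_
    · rw [Pi.smul_apply, smul_eq_mul, map_mul, RingHom.mem_ker.1 hr, zero_mul]
    · rw [Pi.add_apply, map_add, hy, hz, add_zero]
  -- Subtracting the preimage `y`, whose entries lie in `𝔪`, leaves a second syzygy with constant
  -- entry `1`, against minimality.
  have hker : Pi.single k 1 - y ∈ LinearMap.range (R.d 1) := by
    rw [R.exact_succ, LinearMap.mem_ker, map_sub, hyd, sub_self]
  obtain ⟨z, hz⟩ := hker
  have := R.constantCoeff_d 1 z k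
  rw [hz, Pi.sub_apply, map_sub, hy0] at this
  simp at this

end MinimalFreeResolution

end Syzygies

/-! ### From arbitrary resolutions to Betti numbers -/

theorem multigradedBetti_eq_zero {V K : Type*} [Field K] {I : Ideal (MvPolynomial V K)} {i : ℕ}
    {a : V →₀ ℕ} (h : ∀ (R : MinimalFreeResolution I) k, R.deg i k ≠ a) :
    multigradedBetti I i a = 0 := by
  unfold multigradedBetti
  split_ifs with hI
  · have : IsEmpty {k // hI.some.deg i k = a} := ⟨fun k => h _ k.1 k.2⟩
    exact Nat.card_of_isEmpty
  · rfl

/-- Quantifying over all resolutions avoids any appeal to uniqueness; existence is needed because of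
the default value zero. -/
theorem multigradedBetti_ne_zero {V K : Type*} [Field K] {I : Ideal (MvPolynomial V K)} {i : ℕ}
    {a : V →₀ ℕ} (hI : Nonempty (MinimalFreeResolution I))
    (h : ∀ R : MinimalFreeResolution I, ∃ k, R.deg i k = a) : multigradedBetti I i a ≠ 0 := by
  rw [multigradedBetti, dif_pos hI]
  obtain ⟨k, hk⟩ := h hI.some
  have : Nonempty {k // hI.some.deg i k = a} := ⟨⟨k, hk⟩⟩
  exact Nat.card_pos.ne'

namespace Clutter

/-! ### Circuits as squarefree exponents -/

section Exponents

variable {V : Type*}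

/-- The exponent of the squarefree monomial `∏ v ∈ F, X v`. -/
noncomputable def exponent (F : Finset V) : V →₀ ℕ := ∑ v ∈ F, Finsupp.single v 1

theorem exponent_apply [DecidableEq V] (F : Finset V) (v : V) :
    exponent F v = if v ∈ F then 1 else 0 := by
  simp [exponent, Finsupp.finsetSum_apply, Finsupp.single_apply]

theorem exponent_le_exponent {F G : Finset V} : exponent F ≤ exponent G ↔ F ⊆ G := by
  classical
  rw [Finsupp.le_def]
  refine ⟨fun h v hv => ?_, fun h v => ?_⟩
  · have := h v
    rw [exponent_apply, exponent_apply, if_pos hv] at this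
    by_contra hG
    simp [hG] at this
  · rw [exponent_apply, exponent_apply]
    split_ifs with h1 h2 <;> first | exact absurd (h h1) h2 | simp

theorem exponent_injective : Function.Injective (exponent : Finset V → V →₀ ℕ) :=
  fun _ _ h => Finset.Subset.antisymm (exponent_le_exponent.1 h.le) (exponent_le_exponent.1 h.ge)

theorem exponent_sup [DecidableEq V] (F G : Finset V) :
    exponent F ⊔ exponent G = exponent (F ∪ G) := by
  ext v
  rw [Finsupp.sup_apply, exponent_apply, exponent_apply, exponent_apply]
  by_cases h1 : v ∈ F <;> by_cases h2 : v ∈ G <;> simp [h1, h2]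

theorem sum_exponent [Fintype V] (F : Finset V) : ∑ v, exponent F v = F.card := by
  classical
  simp [exponent_apply]

theorem edgeIdeal_eq (K : Type*) [Field K] (C : Clutter V) :
    C.edgeIdeal K = Ideal.span ((fun g => monomial g (1 : K)) ''
      (exponent '' (C.circuits : Set (Finset V)))) := by
  have h : ∀ F : Finset V, monomial (exponent F) (1 : K) = ∏ v ∈ F, X v :=
    fun F => monomial_sum_one F _
  rw [edgeIdeal]
  congr 1
  ext f
  rw [Set.image_image]
  exact exists_congr fun F => and_congr_right fun _ => by rw [← h, eq_comm]

theorem isAntichain_exponent (C : Clutter V) :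
    IsAntichain (· ≤ ·) (exponent '' (C.circuits : Set (Finset V))) := by
  rintro _ ⟨F, hF, rfl⟩ _ ⟨G, hG, rfl⟩ hne hle
  exact C.antichain hF hG (fun h => hne (by rw [h])) (exponent_le_exponent.1 hle)

end Exponents

theorem isUniform_ofUniform {V : Type*} {d : ℕ} {A : Finset (Finset V)}
    (hA : ∀ F ∈ A, F.card = d) : (ofUniform d A hA).IsUniform d := hA

/-! ### Induced subclutters as embeddings -/

section Embeddings

variable {V : Type*} [DecidableEq V]

/-- The set `W` is the range of `f`. This moves the combinatorics to subsets of `Fin n`, where it is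
decidable. -/
theorem exists_induced_isomorphic_iff {n : ℕ} (C : Clutter V) (D : Clutter (Fin n)) :
    (∃ W, (C.induced W).IsIsomorphic D) ↔
      ∃ f : Fin n ↪ V, ∀ T : Finset (Fin n), T.map f ∈ C.circuits ↔ T ∈ D.circuits := by
  have hmem : ∀ (W : Finset V) (F : Finset {v // v ∈ W}), F ∈ (C.induced W).circuits ↔
      F.map (Function.Embedding.subtype (· ∈ W)) ∈ C.circuits := by
    intro W F
    simp only [induced, Finset.mem_filter, Finset.mem_powerset, and_iff_right_iff_imp]
    exact fun _ x _ => Finset.mem_attach _ x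
  constructor
  · rintro ⟨W, e, he⟩
    refine ⟨e.symm.toEmbedding.trans (Function.Embedding.subtype (· ∈ W)), fun T => ?_⟩
    have h := he (T.map e.symm.toEmbedding)
    rw [hmem, Finset.map_map, Finset.map_map] at h
    rw [h]
    simp
  · rintro ⟨f, hf⟩
    let e : Fin n ≃ {v // v ∈ Finset.univ.map f} :=
      Equiv.ofBijective (fun i => ⟨f i, Finset.mem_map_of_mem f (Finset.mem_univ i)⟩)
        ⟨fun i j h => f.injective (congrArg Subtype.val h), fun ⟨v, hv⟩ => by
          obtain ⟨i, -, rfl⟩ := Finset.mem_map.1 hv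
          exact ⟨i, rfl⟩⟩
    refine ⟨Finset.univ.map f, e.symm, fun F => ?_⟩
    rw [hmem, ← hf, Finset.map_map]
    have : e.symm.toEmbedding.trans f = Function.Embedding.subtype (· ∈ Finset.univ.map f) := by
      ext v
      exact congrArg Subtype.val (e.apply_symm_apply v)
    rw [this]

theorem mem_complement [Fintype V] (C : Clutter V) (d : ℕ) (F : Finset V) :
    F ∈ (C.complement d).circuits ↔ F.card = d ∧ F ∉ C.circuits := by
  simp [complement, ofUniform]

/-- The embedding `f` identifies the non-circuits of `D` of size `3` with the circuits of `C` in the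
range of `f`. -/
def IsComplementEmbedding {n : ℕ} (C : Clutter V) (D : Clutter (Fin n)) (f : Fin n ↪ V) : Prop :=
  ∀ T : Finset (Fin n), T.card = 3 → (T.map f ∈ C.circuits ↔ T ∉ D.circuits)

theorem isFree_complement_iff [Fintype V] (C : Clutter V) :
    (C.complement 3).IsFree forbidden ↔
      (∀ f, ¬ C.IsComplementEmbedding bipyramid f) ∧
      (∀ f, ¬ C.IsComplementEmbedding bipyramid₁ f) ∧
      (∀ f, ¬ C.IsComplementEmbedding bipyramid₂ f) ∧
      (∀ f, ¬ C.IsComplementEmbedding twoGap f) := by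
  have key : ∀ {n : ℕ} (D : Clutter (Fin n)), D.IsUniform 3 →
      ((∀ W, ¬ ((C.complement 3).induced W).IsIsomorphic D) ↔
        ∀ f, ¬ C.IsComplementEmbedding D f) := by
    intro n D hD
    rw [← not_exists, exists_induced_isomorphic_iff, not_exists]
    refine forall_congr' fun f => not_congr (forall_congr' fun T => ?_)
    rw [mem_complement, Finset.card_map]
    have := hD T
    tauto
  simp only [IsFree, forbidden, Set.mem_insert_iff, Set.mem_singleton_iff, forall_eq_or_imp,
    forall_eq]
  rw [key bipyramid (isUniform_ofUniform _), key bipyramid₁ (isUniform_ofUniform _),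
    key bipyramid₂ (isUniform_ofUniform _), key twoGap (isUniform_ofUniform _)]

end Embeddings

/-! ### Paths of circuits in five or six vertices -/

section Connectivity

variable {V : Type*}

theorem isComplementEmbedding_of_mem_iff {n : ℕ} {C : Clutter V} {D : Clutter (Fin n)}
    {f : Fin n ↪ V} {Q : Finset (Finset (Fin n))}
    (hQ : ∀ T ∈ Finset.univ.powersetCard 3, T.map f ∈ C.circuits ↔ T ∈ Q)
    (σ : Equiv.Perm (Fin n))
    (hσ : ∀ T ∈ Finset.univ.powersetCard 3, T.map σ.toEmbedding ∈ Q ↔ T ∉ D.circuits) :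
    C.IsComplementEmbedding D (σ.toEmbedding.trans f) := by
  intro T hT
  rw [← Finset.map_map, hQ _ (by simp [hT]), hσ _ (by simp [hT])]

theorem powersetCard_three_fin_five : (Finset.univ : Finset (Fin 5)).powersetCard 3 =
    {{0, 1, 2}, {0, 1, 3}, {0, 1, 4}, {0, 2, 3}, {0, 2, 4}, {0, 3, 4}, {1, 2, 3}, {1, 2, 4},
      {1, 3, 4}, {2, 3, 4}} := by
  decide

/-- Only `034` and `134` are left open: if two, one or none of them are circuits, the complement is
`bipyramid`, `bipyramid₁` or `bipyramid₂`. The base `123` is carried to `012` by `σ` and `τ`, and to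
`234` by `ρ`. -/
theorem exists_isComplementEmbedding_bipyramid {C : Clutter V} (f : Fin 5 ↪ V)
    (h012 : Finset.map f {0, 1, 2} ∈ C.circuits) (h234 : Finset.map f {2, 3, 4} ∈ C.circuits)
    (h023 : Finset.map f {0, 2, 3} ∉ C.circuits) (h024 : Finset.map f {0, 2, 4} ∉ C.circuits)
    (h123 : Finset.map f {1, 2, 3} ∉ C.circuits) (h124 : Finset.map f {1, 2, 4} ∉ C.circuits)
    (h013 : Finset.map f {0, 1, 3} ∉ C.circuits) (h014 : Finset.map f {0, 1, 4} ∉ C.circuits) :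
    (∃ f, C.IsComplementEmbedding bipyramid f) ∨ (∃ f, C.IsComplementEmbedding bipyramid₁ f) ∨
      ∃ f, C.IsComplementEmbedding bipyramid₂ f := by
  have hQ : ∀ Q : Finset (Finset (Fin 5)), {0, 1, 2} ∈ Q → {2, 3, 4} ∈ Q → {0, 2, 3} ∉ Q →
      {0, 2, 4} ∉ Q → {1, 2, 3} ∉ Q → {1, 2, 4} ∉ Q → {0, 1, 3} ∉ Q → {0, 1, 4} ∉ Q →
      (Finset.map f {0, 3, 4} ∈ C.circuits ↔ {0, 3, 4} ∈ Q) →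
      (Finset.map f {1, 3, 4} ∈ C.circuits ↔ {1, 3, 4} ∈ Q) →
      ∀ T ∈ Finset.univ.powersetCard 3, T.map f ∈ C.circuits ↔ T ∈ Q := by
    intro Q h1 h2 h3 h4 h5 h6 h7 h8 h9 h10
    rw [powersetCard_three_fin_five]
    simp only [Finset.forall_mem_insert, Finset.mem_singleton, forall_eq]
    exact ⟨iff_of_true h012 h1, iff_of_false h013 h7, iff_of_false h014 h8, iff_of_false h023 h3,
      iff_of_false h024 h4, h9, iff_of_false h123 h5, iff_of_false h124 h6, h10,
      iff_of_true h234 h2⟩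
  let σ : Equiv.Perm (Fin 5) := ⟨![3, 0, 1, 2, 4], ![1, 2, 3, 0, 4], by decide, by decide⟩
  let τ : Equiv.Perm (Fin 5) := ⟨![3, 1, 0, 2, 4], ![2, 1, 3, 0, 4], by decide, by decide⟩
  let ρ : Equiv.Perm (Fin 5) := ⟨![0, 3, 4, 2, 1], ![0, 4, 3, 1, 2], by decide, by decide⟩
  by_cases h034 : Finset.map f {0, 3, 4} ∈ C.circuits <;>
    by_cases h134 : Finset.map f {1, 3, 4} ∈ C.circuits
  · exact Or.inl ⟨_, isComplementEmbedding_of_mem_iff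
      (hQ {{0, 1, 2}, {2, 3, 4}, {0, 3, 4}, {1, 3, 4}} (by decide) (by decide) (by decide)
        (by decide) (by decide) (by decide) (by decide) (by decide) (iff_of_true h034 (by decide))
        (iff_of_true h134 (by decide))) σ (by decide)⟩
  · exact Or.inr (Or.inl ⟨_, isComplementEmbedding_of_mem_iff
      (hQ {{0, 1, 2}, {2, 3, 4}, {0, 3, 4}} (by decide) (by decide) (by decide)
        (by decide) (by decide) (by decide) (by decide) (by decide) (iff_of_true h034 (by decide))
        (iff_of_false h134 (by decide))) τ (by decide)⟩)
  · exact Or.inr (Or.inl ⟨_, isComplementEmbedding_of_mem_iff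
      (hQ {{0, 1, 2}, {2, 3, 4}, {1, 3, 4}} (by decide) (by decide) (by decide)
        (by decide) (by decide) (by decide) (by decide) (by decide) (iff_of_false h034 (by decide))
        (iff_of_true h134 (by decide))) σ (by decide)⟩)
  · exact Or.inr (Or.inr ⟨_, isComplementEmbedding_of_mem_iff
      (hQ {{0, 1, 2}, {2, 3, 4}} (by decide) (by decide) (by decide)
        (by decide) (by decide) (by decide) (by decide) (by decide) (iff_of_false h034 (by decide))
        (iff_of_false h134 (by decide))) ρ (by decide)⟩)

variable [DecidableEq V]

/-- Two circuits contained in `W` whose union is not `W`. -/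
def Linked (C : Clutter V) (W F G : Finset V) : Prop :=
  F ∈ C.circuits ∧ G ∈ C.circuits ∧ F ⊆ W ∧ G ⊆ W ∧ F ∪ G ≠ W

theorem linked_map {n : ℕ} {C : Clutter V} (f : Fin n ↪ V) {S T : Finset (Fin n)}
    (hS : S.map f ∈ C.circuits) (hT : T.map f ∈ C.circuits) (h : S ∪ T ≠ Finset.univ) :
    C.Linked (Finset.univ.map f) (S.map f) (T.map f) :=
  ⟨hS, hT, Finset.map_subset_map.2 (Finset.subset_univ _),
    Finset.map_subset_map.2 (Finset.subset_univ _), fun h' => h (by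
      rw [← Finset.map_union] at h'
      exact Finset.map_injective f h')⟩

open Relation in
/-- Two circuits of size three meeting in one vertex are connected through linked circuits, unless
the complement contains one of the bi-pyramids. -/
theorem reflTransGen_linked_of_five {C : Clutter V}
    (hB : ∀ f, ¬ C.IsComplementEmbedding bipyramid f)
    (hB₁ : ∀ f, ¬ C.IsComplementEmbedding bipyramid₁ f)
    (hB₂ : ∀ f, ¬ C.IsComplementEmbedding bipyramid₂ f) (f : Fin 5 ↪ V)
    (h012 : Finset.map f {0, 1, 2} ∈ C.circuits) (h234 : Finset.map f {2, 3, 4} ∈ C.circuits) :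
    ReflTransGen (C.Linked (Finset.univ.map f)) (Finset.map f {0, 1, 2})
      (Finset.map f {2, 3, 4}) := by
  have hB' : ∀ {p : Prop}, ((∃ f, C.IsComplementEmbedding bipyramid f) ∨
      (∃ f, C.IsComplementEmbedding bipyramid₁ f) ∨
      ∃ f, C.IsComplementEmbedding bipyramid₂ f) → p := by
    rintro p (⟨f, hf⟩ | ⟨f, hf⟩ | ⟨f, hf⟩)
    exacts [absurd hf (hB f), absurd hf (hB₁ f), absurd hf (hB₂ f)]
  have two : ∀ T : Finset (Fin 5), T.map f ∈ C.circuits → {0, 1, 2} ∪ T ≠ Finset.univ →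
      T ∪ {2, 3, 4} ≠ Finset.univ → ReflTransGen (C.Linked (Finset.univ.map f))
        (Finset.map f {0, 1, 2}) (Finset.map f {2, 3, 4}) := fun T hT h1 h2 =>
    (ReflTransGen.single (linked_map f h012 hT h1)).tail (linked_map f hT h234 h2)
  by_cases h023 : Finset.map f {0, 2, 3} ∈ C.circuits
  · exact two _ h023 (by decide) (by decide)
  by_cases h024 : Finset.map f {0, 2, 4} ∈ C.circuits
  · exact two _ h024 (by decide) (by decide)
  by_cases h123 : Finset.map f {1, 2, 3} ∈ C.circuits
  · exact two _ h123 (by decide) (by decide)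
  by_cases h124 : Finset.map f {1, 2, 4} ∈ C.circuits
  · exact two _ h124 (by decide) (by decide)
  -- With no circuit left through `2` besides the two given ones, a path must leave via `013` or
  -- `014` and return via `034` or `134`.
  have three : ∀ S T : Finset (Fin 5), S.map f ∈ C.circuits → T.map f ∈ C.circuits →
      {0, 1, 2} ∪ S ≠ Finset.univ → S ∪ T ≠ Finset.univ → T ∪ {2, 3, 4} ≠ Finset.univ →
      ReflTransGen (C.Linked (Finset.univ.map f))
        (Finset.map f {0, 1, 2}) (Finset.map f {2, 3, 4}) := fun S T hS hT h1 h2 h3 =>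
    ((ReflTransGen.single (linked_map f h012 hS h1)).tail (linked_map f hS hT h2)).tail
      (linked_map f hT h234 h3)
  -- The symmetry exchanging the two given circuits, for the case where it is `034` and `134` that
  -- are both missing.
  let σ : Equiv.Perm (Fin 5) := ⟨![3, 4, 2, 0, 1], ![3, 4, 2, 0, 1], by decide, by decide⟩
  have hσ : ∀ S T : Finset (Fin 5), S.map σ.toEmbedding = T →
      S.map (σ.toEmbedding.trans f) = T.map f := by
    rintro S _ rfl
    rw [Finset.map_map]
  by_cases h013 : Finset.map f {0, 1, 3} ∈ C.circuits
  · by_cases h034 : Finset.map f {0, 3, 4} ∈ C.circuits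
    · exact three _ _ h013 h034 (by decide) (by decide) (by decide)
    by_cases h134 : Finset.map f {1, 3, 4} ∈ C.circuits
    · exact three _ _ h013 h134 (by decide) (by decide) (by decide)
    refine hB' (exists_isComplementEmbedding_bipyramid (σ.toEmbedding.trans f)
      ?_ ?_ ?_ ?_ ?_ ?_ ?_ ?_)
    · rwa [hσ _ {2, 3, 4} (by decide)]
    · rwa [hσ _ {0, 1, 2} (by decide)]
    · rwa [hσ _ {0, 2, 3} (by decide)]
    · rwa [hσ _ {1, 2, 3} (by decide)]
    · rwa [hσ _ {0, 2, 4} (by decide)]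
    · rwa [hσ _ {1, 2, 4} (by decide)]
    · rwa [hσ _ {0, 3, 4} (by decide)]
    · rwa [hσ _ {1, 3, 4} (by decide)]
  by_cases h014 : Finset.map f {0, 1, 4} ∈ C.circuits
  · by_cases h034 : Finset.map f {0, 3, 4} ∈ C.circuits
    · exact three _ _ h014 h034 (by decide) (by decide) (by decide)
    by_cases h134 : Finset.map f {1, 3, 4} ∈ C.circuits
    · exact three _ _ h014 h134 (by decide) (by decide) (by decide)
    refine hB' (exists_isComplementEmbedding_bipyramid (σ.toEmbedding.trans f)
      ?_ ?_ ?_ ?_ ?_ ?_ ?_ ?_)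
    · rwa [hσ _ {2, 3, 4} (by decide)]
    · rwa [hσ _ {0, 1, 2} (by decide)]
    · rwa [hσ _ {0, 2, 3} (by decide)]
    · rwa [hσ _ {1, 2, 3} (by decide)]
    · rwa [hσ _ {0, 2, 4} (by decide)]
    · rwa [hσ _ {1, 2, 4} (by decide)]
    · rwa [hσ _ {0, 3, 4} (by decide)]
    · rwa [hσ _ {1, 3, 4} (by decide)]
  exact hB' (exists_isComplementEmbedding_bipyramid f h012 h234 h023 h024 h123 h124 h013 h014)

end Connectivity

end Clutter

namespace Clutter

section Connectivity

variable {V : Type*} [DecidableEq V]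

open Relation in
/-- Two disjoint circuits of size three are connected through linked circuits, unless the complement
contains `twoGap`. -/
theorem reflTransGen_linked_of_six {C : Clutter V} (hC : C.IsUniform 3)
    (hB' : ∀ f, ¬ C.IsComplementEmbedding twoGap f) (f : Fin 6 ↪ V)
    (h012 : Finset.map f {0, 1, 2} ∈ C.circuits) (h345 : Finset.map f {3, 4, 5} ∈ C.circuits) :
    ReflTransGen (C.Linked (Finset.univ.map f)) (Finset.map f {0, 1, 2})
      (Finset.map f {3, 4, 5}) := by
  have huniv : ({0, 1, 2} : Finset (Fin 6)) ∪ {3, 4, 5} = Finset.univ := by decide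
  by_cases hex : ∃ T : Finset (Fin 6), T.map f ∈ C.circuits ∧ T ≠ {0, 1, 2} ∧ T ≠ {3, 4, 5}
  · obtain ⟨T, hT, h1, h2⟩ := hex
    have hTc : T.card = 3 := by rw [← Finset.card_map f, hC _ hT]
    -- A triple covering all six vertices together with one of the two circuits must be the other
    -- one, so any third circuit is linked to both.
    refine (ReflTransGen.single (linked_map f h012 hT fun h => h2 ?_)).tail
      (linked_map f hT h345 fun h => h1 ?_)
    · refine (Finset.eq_of_subset_of_card_le (fun x hx => ?_) (by rw [hTc]; decide)).symm
      have := Finset.mem_union.1 (h ▸ Finset.mem_univ x)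
      exact this.resolve_left fun h0 =>
        Finset.disjoint_left.1 (by decide : Disjoint {0, 1, 2} ({3, 4, 5} : Finset (Fin 6))) h0 hx
    · refine (Finset.eq_of_subset_of_card_le (fun x hx => ?_) (by rw [hTc]; decide)).symm
      have := Finset.mem_union.1 (h ▸ Finset.mem_univ x)
      exact this.resolve_right fun h0 =>
        Finset.disjoint_left.1 (by decide : Disjoint {0, 1, 2} ({3, 4, 5} : Finset (Fin 6))) hx h0
  · push Not at hex
    refine absurd (fun T hT => ?_) (hB' f)
    have hD : T ∉ twoGap.circuits ↔ T = {0, 1, 2} ∨ T = {3, 4, 5} := by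
      simp [twoGap, ofUniform, hT, or_iff_not_imp_left]
    rw [hD]
    constructor
    · intro h
      by_contra! h'
      exact h'.2 (hex T h h'.1)
    · rintro (rfl | rfl)
      exacts [h012, h345]

open Relation in
-- Two triples with at least five vertices in their union are disjoint or meet in one vertex, which
-- are the two local cases.
theorem reflTransGen_linked [Fintype V] {C : Clutter V} (hC : C.IsUniform 3)
    (hfree : (C.complement 3).IsFree forbidden) {F G : Finset V} (hF : F ∈ C.circuits)
    (hG : G ∈ C.circuits) (hcard : 5 ≤ (F ∪ G).card) :
    ReflTransGen (C.Linked (F ∪ G)) F G := by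
  obtain ⟨hB, hB₁, hB₂, hB'⟩ := C.isFree_complement_iff.1 hfree
  have h := Finset.card_union_add_card_inter F G
  rw [hC F hF, hC G hG] at h
  obtain h0 | h1 : (F ∩ G).card = 0 ∨ (F ∩ G).card = 1 := by omega
  · rw [Finset.card_eq_zero, ← Finset.disjoint_iff_inter_eq_empty] at h0
    obtain ⟨x, y, z, hxy, hxz, hyz, rfl⟩ := Finset.card_eq_three.1 (hC F hF)
    obtain ⟨u, v, w, huv, huw, hvw, rfl⟩ := Finset.card_eq_three.1 (hC G hG)
    simp only [Finset.disjoint_insert_left, Finset.disjoint_singleton_left, Finset.mem_insert,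
      Finset.mem_singleton, not_or] at h0
    let f : Fin 6 ↪ V := ⟨![x, y, z, u, v, w], by
      obtain ⟨⟨h1, h2, h3⟩, ⟨h4, h5, h6⟩, h7, h8, h9⟩ := h0
      intro i j
      fin_cases i <;> fin_cases j <;> simp [*, Ne.symm, eq_comm]⟩
    have e1 : Finset.map f {0, 1, 2} = {x, y, z} := by simp [f, Finset.map_insert]
    have e2 : Finset.map f {3, 4, 5} = {u, v, w} := by simp [f, Finset.map_insert]
    have := reflTransGen_linked_of_six hC hB' f (e1 ▸ hF) (e2 ▸ hG)
    rwa [show (Finset.univ : Finset (Fin 6)) = {0, 1, 2} ∪ {3, 4, 5} by decide, Finset.map_union,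
      e1, e2] at this
  · obtain ⟨z, hz⟩ := Finset.card_eq_one.1 h1
    have hzm := Finset.mem_inter.1 (hz ▸ Finset.mem_singleton_self z)
    have hF2 : (F.erase z).card = 2 := by rw [Finset.card_erase_of_mem hzm.1, hC F hF]
    have hG2 : (G.erase z).card = 2 := by rw [Finset.card_erase_of_mem hzm.2, hC G hG]
    obtain ⟨x, y, hxy, hFe⟩ := Finset.card_eq_two.1 hF2
    obtain ⟨u, v, huv, hGe⟩ := Finset.card_eq_two.1 hG2
    have hdisj : Disjoint (F.erase z) (G.erase z) := by
      rw [Finset.disjoint_left]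
      intro t ht ht'
      have : t ∈ F ∩ G := Finset.mem_inter.2 ⟨Finset.mem_of_mem_erase ht,
        Finset.mem_of_mem_erase ht'⟩
      rw [hz, Finset.mem_singleton] at this
      exact Finset.ne_of_mem_erase ht this
    have hzF : z ∉ F.erase z := Finset.notMem_erase z F
    have hzG : z ∉ G.erase z := Finset.notMem_erase z G
    have hF' : {x, y, z} = F := by
      rw [← Finset.insert_erase hzm.1, hFe, Finset.insert_comm z, Finset.pair_comm z]
    have hG' : {z, u, v} = G := by rw [← Finset.insert_erase hzm.2, hGe]
    rw [hFe] at hzF hdisj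
    rw [hGe] at hzG hdisj
    simp only [Finset.disjoint_insert_left, Finset.disjoint_singleton_left, Finset.mem_insert,
      Finset.mem_singleton, not_or] at hzF hzG hdisj
    let f : Fin 5 ↪ V := ⟨![x, y, z, u, v], by
      obtain ⟨⟨h1, h2⟩, h3, h4⟩ := hdisj
      obtain ⟨h5, h6⟩ := hzF
      obtain ⟨h7, h8⟩ := hzG
      clear hz hzm hF' hG' hFe hGe
      intro i j
      fin_cases i <;> fin_cases j <;> simp [*, Ne.symm, eq_comm]⟩
    have e1 : Finset.map f {0, 1, 2} = F := by simp [f, Finset.map_insert, hF']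
    have e2 : Finset.map f {2, 3, 4} = G := by simp [f, Finset.map_insert, hG']
    have := reflTransGen_linked_of_five hB hB₁ hB₂ f (e1 ▸ hF) (e2 ▸ hG)
    rwa [show (Finset.univ : Finset (Fin 5)) = {0, 1, 2} ∪ {2, 3, 4} by decide, Finset.map_union,
      e1, e2] at this

end Connectivity

/-! ### Betti numbers of the edge ideal -/

section Betti

variable {V : Type*} (K : Type*) [Field K] {C : Clutter V}

theorem multigradedBetti_one_eq_zero_of_circuits_eq_empty (hC : C.circuits = ∅) (a : V →₀ ℕ) :
    multigradedBetti (C.edgeIdeal K) 1 a = 0 := by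
  rw [edgeIdeal_eq]
  refine multigradedBetti_eq_zero fun R k => R.deg_one_ne C.isAntichain_exponent ?_ ?_ k <;>
    simp [hC]

theorem isGeneratedInDegree_edgeIdeal {d : ℕ} (hC : C.IsUniform d) :
    IsGeneratedInDegree (C.edgeIdeal K) d := by
  refine ⟨_, ?_, rfl⟩
  rintro _ ⟨F, hF, rfl⟩
  rw [← hC F hF, Finset.card_eq_sum_ones]
  exact IsHomogeneous.prod _ _ _ fun v _ => isHomogeneous_X K v

variable [Fintype V]

theorem multigradedBetti_zero_eq_zero (hC : C.IsUniform 3) {a : V →₀ ℕ} (ha : ∑ v, a v ≠ 3) :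
    multigradedBetti (C.edgeIdeal K) 0 a = 0 := by
  rw [edgeIdeal_eq]
  refine multigradedBetti_eq_zero fun R k hk => ha ?_
  obtain ⟨F, hF, hFk⟩ := R.deg_mem C.isAntichain_exponent k
  rw [← hk, ← hFk, sum_exponent, hC F hF]

variable [DecidableEq V]

/-- Generators whose lcm is not `a` are joined directly; otherwise `a` is the exponent of a union of
two circuits and `reflTransGen_linked` applies. -/
theorem multigradedBetti_one_eq_zero (hC : C.IsUniform 3)
    (hfree : (C.complement 3).IsFree forbidden) {a : V →₀ ℕ} (ha : 5 ≤ ∑ v, a v) :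
    multigradedBetti (C.edgeIdeal K) 1 a = 0 := by
  rw [edgeIdeal_eq]
  refine multigradedBetti_eq_zero fun R k => R.deg_one_ne C.isAntichain_exponent ?_ ?_ k
  · rintro ⟨F, hF, rfl⟩
    rw [sum_exponent, hC F hF] at ha
    omega
  · rintro _ ⟨F, hF, rfl⟩ _ ⟨G, hG, rfl⟩ hFa hGa
    by_cases hsup : exponent F ⊔ exponent G = a
    · rw [exponent_sup] at hsup
      subst hsup
      rw [sum_exponent] at ha
      refine (reflTransGen_linked hC hfree hF hG ha).lift exponent fun P Q h => ?_
      obtain ⟨hP, hQ, hPW, hQW, hne⟩ := h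
      refine ⟨⟨P, hP, rfl⟩, ⟨Q, hQ, rfl⟩, exponent_le_exponent.2 hPW, exponent_le_exponent.2 hQW,
        fun h => hne ?_⟩
      rw [exponent_sup] at h
      exact exponent_injective h
    · exact Relation.ReflTransGen.single ⟨⟨F, hF, rfl⟩, ⟨G, hG, rfl⟩, hFa, hGa, hsup⟩

/-- An embedding of a clutter `D` for which some non-circuit covers all vertices together with every
other non-circuit yields a minimal syzygy. -/
theorem gradedBetti_one_ne_zero (hC : C.IsUniform 3) {n : ℕ} {D : Clutter (Fin n)} {f : Fin n ↪ V}
    (hf : C.IsComplementEmbedding D f) {T₀ T₁ : Finset (Fin n)}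
    (h₀ : T₀ ∈ Finset.univ.powersetCard 3 \ D.circuits)
    (h₁ : T₁ ∈ Finset.univ.powersetCard 3 \ D.circuits) (hne : T₁ ≠ T₀)
    (hiso : ∀ T ∈ Finset.univ.powersetCard 3 \ D.circuits, T ≠ T₀ → T₀ ∪ T = Finset.univ) :
    gradedBetti (C.edgeIdeal K) 1 n ≠ 0 := by
  have hmem : ∀ T, T ∈ Finset.univ.powersetCard 3 \ D.circuits ↔ T.map f ∈ C.circuits := by
    intro T
    rw [Finset.mem_sdiff, Finset.mem_powersetCard_univ]
    constructor
    · rintro ⟨h3, hT⟩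
      exact (hf T h3).2 hT
    · intro hT
      have h3 : T.card = 3 := by rw [← Finset.card_map f, hC _ hT]
      exact ⟨h3, (hf T h3).1 hT⟩
  have hle : ∀ T : Finset (Fin n), exponent (T.map f) ≤ exponent (Finset.univ.map f) := fun T =>
    exponent_le_exponent.2 (Finset.map_subset_map.2 (Finset.subset_univ T))
  intro h
  have ha : exponent (Finset.univ.map f) ∈ (Finset.univ : Finset V).finsuppAntidiag n := by
    rw [Finset.mem_finsuppAntidiag]
    refine ⟨?_, Finset.subset_univ _⟩
    rw [sum_exponent, Finset.card_map, Finset.card_univ, Fintype.card_fin]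
  have h := Finset.sum_eq_zero_iff.1 h _ ha
  revert h
  rw [edgeIdeal_eq]
  refine multigradedBetti_ne_zero (nonempty_minimalFreeResolution _) fun R => ?_
  refine R.exists_deg_one_eq C.isAntichain_exponent ⟨_, (hmem T₀).1 h₀, rfl⟩
    ⟨_, (hmem T₁).1 h₁, rfl⟩ (fun h => hne ?_) (hle _) (hle _) ?_
  · exact Finset.map_injective f (exponent_injective h)
  · rintro _ ⟨H, hH, rfl⟩ hHle hHne
    obtain ⟨T, -, rfl⟩ := Finset.subset_map_iff.1 (exponent_le_exponent.1 hHle)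
    rw [exponent_sup, ← Finset.map_union, hiso T ((hmem T).2 hH) fun h => hHne (by rw [h])]

theorem isFree_of_gradedBetti_eq_zero (hC : C.IsUniform 3)
    (h5 : gradedBetti (C.edgeIdeal K) 1 5 = 0) (h6 : gradedBetti (C.edgeIdeal K) 1 6 = 0) :
    (C.complement 3).IsFree forbidden := by
  rw [isFree_complement_iff]
  refine ⟨fun f hf => ?_, fun f hf => ?_, fun f hf => ?_, fun f hf => ?_⟩
  -- The base `123` is the isolated non-circuit; `034` is a non-circuit of all three bi-pyramid
  -- variants.
  · exact gradedBetti_one_ne_zero K hC hf (T₀ := {1, 2, 3}) (T₁ := {0, 3, 4}) (by decide)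
      (by decide) (by decide) (by decide) h5
  · exact gradedBetti_one_ne_zero K hC hf (T₀ := {1, 2, 3}) (T₁ := {0, 3, 4}) (by decide)
      (by decide) (by decide) (by decide) h5
  · exact gradedBetti_one_ne_zero K hC hf (T₀ := {1, 2, 3}) (T₁ := {0, 3, 4}) (by decide)
      (by decide) (by decide) (by decide) h5
  · exact gradedBetti_one_ne_zero K hC hf (T₀ := {0, 1, 2}) (T₁ := {3, 4, 5}) (by decide)
      (by decide) (by decide) (by decide) h6

theorem isStepLinear_one_of_isFree (hC : C.IsUniform 3)
    (hfree : (C.complement 3).IsFree forbidden) : IsStepLinear (C.edgeIdeal K) 1 := by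
  refine ⟨3, isGeneratedInDegree_edgeIdeal K hC, fun i j hi hj => ?_⟩
  refine Finset.sum_eq_zero fun a ha => ?_
  have hsum := (Finset.mem_finsuppAntidiag.1 ha).1
  interval_cases i
  · exact multigradedBetti_zero_eq_zero K hC (by rw [hsum]; omega)
  · exact multigradedBetti_one_eq_zero K hC hfree (by rw [hsum]; omega)

end Betti

end Clutter

/-! ### The index and the equivalence -/

theorem IsGeneratedInDegree.le_degree {V K : Type*} [Field K] {I : Ideal (MvPolynomial V K)}
    {d : ℕ} (h : IsGeneratedInDegree I d) {p : MvPolynomial V K} (hp : p ∈ I) {m : V →₀ ℕ}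
    (hm : m ∈ p.support) : d ≤ m.degree := by
  classical
  obtain ⟨G, hG, rfl⟩ := h
  induction hp using Submodule.span_induction generalizing m with
  | mem g hg =>
    have := hG g hg (mem_support_iff.1 hm)
    rw [← this, Finsupp.degree_eq_weight_one]
    exact le_rfl
  | zero => simp at hm
  | add p q _ _ hp hq =>
    rcases Finset.mem_union.1 (support_add hm) with h | h
    exacts [hp h, hq h]
  | smul r p _ hp =>
    obtain ⟨a, -, b, hb, rfl⟩ := Finset.mem_add.1 (support_mul r p hm)
    rw [map_add]
    exact (hp hb).trans le_add_self

/-- Step linearity passes from `r` to smaller values, so a positive supremum already gives the case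
`r = 1`. -/
theorem one_lt_glIndex_iff {V K : Type*} [Field K] [Fintype V] [DecidableEq V]
    (I : Ideal (MvPolynomial V K)) : 1 < glIndex I ↔ IsStepLinear I 1 := by
  have h0 : 1 < glIndex I ↔ 0 < ⨆ r ∈ {r : ℕ | IsStepLinear I r}, (r : ℕ∞) := by
    rw [glIndex]
    have h := ENat.add_lt_add_iff_right (n := 0)
      (m := ⨆ r ∈ {r : ℕ | IsStepLinear I r}, (r : ℕ∞)) ENat.one_ne_top
    rwa [zero_add] at h
  rw [h0]
  simp only [lt_iSup_iff]
  constructor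
  · rintro ⟨r, ⟨d, hd, hr⟩, hpos⟩
    have : 1 ≤ r := by exact_mod_cast hpos
    exact ⟨d, hd, fun i j hi => hr i j (hi.trans this)⟩
  · exact fun h => ⟨1, h, by simp⟩

theorem theorem2p3 {V K : Type*} [Fintype V] [DecidableEq V] [Field K]
    (C : Clutter V) (hC : C.IsUniform 3) :
    List.TFAE [
      (C.complement 3).IsFree Clutter.forbidden,
      1 < glIndex (C.edgeIdeal K),
      gradedBetti (C.edgeIdeal K) 1 5 = 0 ∧ gradedBetti (C.edgeIdeal K) 1 6 = 0] := by
  rw [one_lt_glIndex_iff]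
  tfae_have 1 → 2 := C.isStepLinear_one_of_isFree K hC
  tfae_have 3 → 1 := fun h => C.isFree_of_gradedBetti_eq_zero K hC h.1 h.2
  tfae_have 2 → 3 := by
    rintro ⟨d, hd, hlin⟩
    -- The degree `d` in the definition need not be `3`. A smaller `d` only strengthens the
    -- vanishing; a larger one is incompatible with any circuit and leaves the zero ideal.
    by_cases hd3 : d ≤ 3
    · exact ⟨hlin 1 5 le_rfl (by omega), hlin 1 6 le_rfl (by omega)⟩
    have hempty : C.circuits = ∅ := by
      refine Finset.eq_empty_of_forall_notMem fun F hF => hd3 ?_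
      have hmem : monomial (Clutter.exponent F) (1 : K) ∈ C.edgeIdeal K := by
        rw [Clutter.edgeIdeal_eq]
        exact Ideal.subset_span ⟨_, ⟨F, hF, rfl⟩, rfl⟩
      have := hd.le_degree hmem (m := Clutter.exponent F) (by simp)
      rwa [Finsupp.degree_eq_sum, Clutter.sum_exponent, hC F hF] at this
    exact ⟨Finset.sum_eq_zero fun a _ =>
        C.multigradedBetti_one_eq_zero_of_circuits_eq_empty K hempty a,
      Finset.sum_eq_zero fun a _ =>
        C.multigradedBetti_one_eq_zero_of_circuits_eq_empty K hempty a⟩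
  tfae_finish
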